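/- Let $\mathbb{D}=\{z\in\mathbb{C}:|z|<1\}$, let $-1/2<\alpha<0$ and let $n\ge 2$ be an integer. Let $h$ and $g$ be analytic in $\mathbb{D}$ with $h'(z)\neq 0$ for all $z\in\mathbb{D}$, $$\operatorname{Re}\left(1+\frac{zh''(z)}{h'(z)}\right)>\alpha\quad(z\in\mathbb{D})\qquad\text{and}\qquad g'(z)=z^n h'(z)\quad(z\in\mathbb{D}).$$ Then $f=h+\overline{g}$ is a close-to-convex harmonic mapping in the disk $$U=\left\{z:\ |z|<\sqrt[n]{\frac{1+2\alpha}{1+2n+2\alpha}}\right\};$$ that is, $f$ is harmonic and injective in $U$, and $f(U)$ is a close-to-convex domain: a nonempty connected open set whose complement in $\mathbb{C}$ is a union of pairwise disjoint closed half-lines. -/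

import Mathlib

/-- A (closed) half-line in the complex plane. -/
def IsHalfLine (L : Set ℂ) : Prop :=
  ∃ p v : ℂ, v ≠ 0 ∧ L = {w : ℂ | ∃ t : ℝ, 0 ≤ t ∧ w = p + (t : ℂ) * v}

/-- A close-to-convex domain: a domain (a nonempty connected open set) whose complement is a
union of pairwise non-intersecting half-lines. -/
def IsCloseToConvexDomain (Ω : Set ℂ) : Prop :=
  IsOpen Ω ∧ IsConnected Ω ∧
    ∃ S : Set (Set ℂ), (∀ L ∈ S, IsHalfLine L) ∧ S.Pairwise Disjoint ∧ ⋃₀ S = Ωᶜ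

/-- `f` is a close-to-convex harmonic mapping in the open set `U`: it is harmonic and injective
in `U` and maps `U` onto a close-to-convex domain. -/
def IsCloseToConvexHarmonicOn (f : ℂ → ℂ) (U : Set ℂ) : Prop :=
  InnerProductSpace.HarmonicOnNhd f U ∧ Set.InjOn f U ∧ IsCloseToConvexDomain (f '' U)

/-! Let `P 0 = 0` and `h' = h'(0) exp ((1 - α) P)`, and let `ψ' = h'(0) exp P`. The hypothesis on
`h` says exactly that `Re (1 + z ψ''/ψ') > 0`, so `ψ` is injective and maps concentric disks onto
convex sets (`injOn_of_convexity`, `convex_image_ball`). Moreover `h'/ψ' = exp (-α P)` and `|Im P| ≤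
π` (`abs_im_le_pi`), so the argument of `h'/ψ'` is at most `-α π < π / 2` in size. On the closed
disk `|z| ^ n` is less than the cosine of that argument, which gives `|g'/ψ'| < Re (h'/ψ')`.

In the coordinate `w = ψ z` this makes `T = f ∘ ψ⁻¹` strongly monotone and Lipschitz on the compact
convex set `K = ψ(closed disk)`. Every point of the plane is uniquely `a + m` with `a ∈ K` and `m`
an outward normal at `a`. For a suitable `M`, the map `a + m ↦ T a + M m` is strongly monotone and
Lipschitz on the whole plane, hence a homeomorphism (`exists_homeomorph_extend_normal`). It gives
injectivity of `f`, and it carries the outward normal half-lines of `K`, which are disjoint and fill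
the complement of `ψ(open disk)`, onto half-lines filling the complement of `f(U)`. -/

/-! ### Strongly monotone maps and normals of convex sets -/

/-- Points of a set at which a normal vector is attached are determined by the sum. -/
theorem eq_of_add_normal_eq {E : Type*} [NormedAddCommGroup E] [InnerProductSpace ℝ E]
    {K : Set E} {a b m k : E} (ha : a ∈ K) (hb : b ∈ K) (hm : ∀ x ∈ K, inner ℝ m (x - a) ≤ 0)
    (hk : ∀ x ∈ K, inner ℝ k (x - b) ≤ 0) (h : a + m = b + k) : a = b := by
  have h1 := hm b hb
  have h2 := hk a ha
  have h3 : m - k = b - a := by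
    rw [sub_eq_sub_iff_add_eq_add, add_comm m a, add_comm b k, h, add_comm]
  have h4 : inner ℝ (m - k) (b - a) ≤ 0 := by
    rw [inner_sub_left]
    have : inner ℝ k (b - a) = - inner ℝ k (a - b) := by rw [← inner_neg_right, neg_sub]
    linarith
  rw [h3, real_inner_self_eq_norm_sq] at h4
  have h5 : ‖b - a‖ = 0 := by nlinarith [norm_nonneg (b - a)]
  exact (sub_eq_zero.1 (norm_eq_zero.1 h5)).symm

/-- A point of the ambient space is a point of a closed convex set plus a normal vector. -/
theorem exists_add_normal_eq {E : Type*} [NormedAddCommGroup E] [InnerProductSpace ℝ E]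
    [CompleteSpace E] {K : Set E} (hne : K.Nonempty) (hcl : IsClosed K) (hco : Convex ℝ K) (p : E) :
    ∃ a ∈ K, ∀ x ∈ K, inner ℝ (p - a) (x - a) ≤ 0 := by
  obtain ⟨a, ha, h⟩ := exists_norm_eq_iInf_of_complete_convex hne hcl.isComplete hco p
  exact ⟨a, ha, (norm_eq_iInf_iff_real_inner_le_zero hco ha).1 h⟩

/-- A Lipschitz strongly monotone map of a Hilbert space is surjective. -/
theorem surjective_of_strongly_monotone {E : Type*} [NormedAddCommGroup E] [InnerProductSpace ℝ E]
    [CompleteSpace E] {T : E → E} {c Λ : ℝ} (hc : 0 < c)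
    (hmono : ∀ a b, c * ‖a - b‖ ^ 2 ≤ inner ℝ (T a - T b) (a - b))
    (hlip : ∀ a b, ‖T a - T b‖ ≤ Λ * ‖a - b‖) : Function.Surjective T := by
  intro y
  -- Enlarging `Λ` gives `N > 0` and `c ≤ N`. The step `t = c / N ^ 2` minimises the squared
  -- contraction factor `1 - 2 c t + t ^ 2 N ^ 2`, with minimum `1 - c t ∈ [0, 1)`.
  set N : ℝ := max Λ (2 * c) with hN
  have hNpos : 0 < N := lt_of_lt_of_le (by linarith) (le_max_right _ _)
  have hlip' : ∀ a b, ‖T a - T b‖ ≤ N * ‖a - b‖ := fun a b =>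
    (hlip a b).trans (mul_le_mul_of_nonneg_right (le_max_left _ _) (norm_nonneg _))
  set t : ℝ := c / N ^ 2 with ht
  have htpos : 0 < t := by positivity
  have hq0 : 0 ≤ 1 - c * t := by
    have : c * t ≤ 1 := by
      rw [ht, ← mul_div_assoc, div_le_one (by positivity)]
      have : c ≤ N := le_trans (by linarith) (le_max_right Λ (2 * c))
      nlinarith
    linarith
  have hq1 : 1 - c * t < 1 := by nlinarith
  set q : NNReal := ⟨Real.sqrt (1 - c * t), Real.sqrt_nonneg _⟩ with hq
  have hcontr : ContractingWith q (fun p => p - t • (T p - y)) := by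
    refine ⟨?_, LipschitzWith.of_dist_le_mul fun a b => ?_⟩
    · rw [← NNReal.coe_lt_coe]
      change Real.sqrt (1 - c * t) < 1
      rw [Real.sqrt_lt' one_pos]
      linarith
    · rw [dist_eq_norm, dist_eq_norm]
      change _ ≤ Real.sqrt (1 - c * t) * _
      refine (sq_le_sq₀ (norm_nonneg _) (by positivity)).1 ?_
      rw [mul_pow, Real.sq_sqrt hq0]
      have e : a - t • (T a - y) - (b - t • (T b - y)) = (a - b) - t • (T a - T b) := by
        module
      rw [e, norm_sub_sq_real, inner_smul_right, norm_smul, real_inner_comm, Real.norm_eq_abs,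
        abs_of_pos htpos]
      have h1 := hmono a b
      have h2 := hlip' a b
      have h3 : ‖T a - T b‖ ^ 2 ≤ N ^ 2 * ‖a - b‖ ^ 2 := by
        rw [← mul_pow]; exact pow_le_pow_left₀ (norm_nonneg _) h2 2
      have h4 : t ^ 2 * N ^ 2 = c * t := by
        rw [ht]; field_simp
      have h5 : (t * ‖T a - T b‖) ^ 2 ≤ c * t * ‖a - b‖ ^ 2 := by
        rw [mul_pow, ← h4, mul_assoc]
        exact mul_le_mul_of_nonneg_left h3 (by positivity)
      nlinarith
  refine ⟨hcontr.fixedPoint, ?_⟩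
  have := hcontr.fixedPoint_isFixedPt
  rw [Function.IsFixedPt, sub_eq_self, smul_eq_zero, sub_eq_zero] at this
  exact this.resolve_left htpos.ne'

/-- A Lipschitz strongly monotone map on a closed convex set extends to a homeomorphism of the
space that maps each normal half-line affinely onto a parallel half-line. -/
theorem exists_homeomorph_extend_normal {E : Type*} [NormedAddCommGroup E] [InnerProductSpace ℝ E]
    [CompleteSpace E] {K : Set E} (hne : K.Nonempty) (hcl : IsClosed K) (hco : Convex ℝ K)
    {T : E → E} {c Λ : ℝ} (hc : 0 < c)
    (hmono : ∀ a ∈ K, ∀ b ∈ K, c * ‖a - b‖ ^ 2 ≤ inner ℝ (T a - T b) (a - b))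
    (hlip : ∀ a ∈ K, ∀ b ∈ K, ‖T a - T b‖ ≤ Λ * ‖a - b‖) :
    ∃ (M : ℝ) (e : E ≃ₜ E), 0 < M ∧
      ∀ a ∈ K, ∀ m, (∀ x ∈ K, inner ℝ m (x - a) ≤ 0) → e (a + m) = T a + M • m := by
  choose π hπK hπ using exists_add_normal_eq hne hcl hco
  -- With `x` the difference of projections and `y` that of normals, the bad cross term `Λ ‖x‖ ‖y‖`
  -- is split by Young's inequality; this `M` absorbs its `y` part and leaves `c / 2` on both
  -- squares.
  set M : ℝ := c / 2 + Λ ^ 2 / (2 * c) with hM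
  have hMpos : 0 < M := by positivity
  set G : E → E := fun p => T (π p) + M • (p - π p) with hG
  -- Normals form a monotone operator: add the variational inequalities at the two projections.
  have hnorm : ∀ p q, 0 ≤ inner ℝ ((p - π p) - (q - π q)) (π p - π q) := by
    intro p q
    have h1 := hπ p (π q) (hπK q)
    have h2 := hπ q (π p) (hπK p)
    rw [← neg_sub (π p) (π q), inner_neg_right] at h1
    rw [inner_sub_left]
    linarith
  have hdec : ∀ p q : E, p - q = (π p - π q) + ((p - π p) - (q - π q)) := fun p q => by abel
  have hGdec : ∀ p q : E, G p - G q = (T (π p) - T (π q)) + M • ((p - π p) - (q - π q)) :=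
    fun p q => by simp only [hG]; module
  have hGmono : ∀ p q, (c / 4) * ‖p - q‖ ^ 2 ≤ inner ℝ (G p - G q) (p - q) := by
    intro p q
    have h0 := hnorm p q
    have h1 := hmono _ (hπK p) _ (hπK q)
    have h2 := hlip _ (hπK p) _ (hπK q)
    rw [hGdec, hdec p q]
    generalize T (π p) - T (π q) = D at *
    generalize (p - π p) - (q - π q) = y at *
    generalize π p - π q = x at *
    rw [inner_add_left, inner_add_right, inner_add_right, inner_smul_left, inner_smul_left,
      real_inner_self_eq_norm_sq]
    simp only [conj_trivial]
    have h3 : -(Λ * ‖x‖ * ‖y‖) ≤ inner ℝ D y := by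
      have := abs_real_inner_le_norm D y
      have h4 := mul_le_mul_of_nonneg_right h2 (norm_nonneg y)
      linarith [neg_abs_le (inner ℝ D y)]
    have h5 : Λ * ‖x‖ * ‖y‖ ≤ c / 2 * ‖x‖ ^ 2 + Λ ^ 2 / (2 * c) * ‖y‖ ^ 2 := by
      have : c / 2 * ‖x‖ ^ 2 + Λ ^ 2 / (2 * c) * ‖y‖ ^ 2 - Λ * ‖x‖ * ‖y‖
          = (c * ‖x‖ - Λ * ‖y‖) ^ 2 / (2 * c) := by field_simp; ring
      have h6 : 0 ≤ (c * ‖x‖ - Λ * ‖y‖) ^ 2 / (2 * c) := by positivity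
      linarith
    have h7 : ‖x + y‖ ^ 2 ≤ 2 * (‖x‖ ^ 2 + ‖y‖ ^ 2) := by
      have := norm_add_le x y
      nlinarith [sq_nonneg (‖x‖ - ‖y‖), norm_nonneg (x + y)]
    have h8 : 0 ≤ M * inner ℝ y x := by positivity
    have h9 : M * ‖y‖ ^ 2 = c / 2 * ‖y‖ ^ 2 + Λ ^ 2 / (2 * c) * ‖y‖ ^ 2 := by rw [hM]; ring
    nlinarith
  have hGlip : ∀ p q, ‖G p - G q‖ ≤ (|Λ| + M) * ‖p - q‖ := by
    intro p q
    have h0 := hnorm p q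
    have h2 := hlip _ (hπK p) _ (hπK q)
    rw [hGdec, hdec p q]
    generalize T (π p) - T (π q) = D at *
    generalize (p - π p) - (q - π q) = y at *
    generalize π p - π q = x at *
    have h3 : ‖x + y‖ ^ 2 = ‖x‖ ^ 2 + 2 * inner ℝ x y + ‖y‖ ^ 2 := norm_add_sq_real x y
    rw [real_inner_comm] at h0
    have hx : ‖x‖ ≤ ‖x + y‖ := (sq_le_sq₀ (norm_nonneg _) (norm_nonneg _)).1 (by nlinarith [sq_nonneg ‖y‖])
    have hy : ‖y‖ ≤ ‖x + y‖ := (sq_le_sq₀ (norm_nonneg _) (norm_nonneg _)).1 (by nlinarith [sq_nonneg ‖x‖])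
    calc ‖D + M • y‖ ≤ ‖D‖ + ‖M • y‖ := norm_add_le _ _
      _ ≤ |Λ| * ‖x + y‖ + M * ‖x + y‖ := by
        rw [norm_smul, Real.norm_eq_abs, abs_of_pos hMpos]
        refine add_le_add (h2.trans ?_) (mul_le_mul_of_nonneg_left hy hMpos.le)
        exact mul_le_mul (le_abs_self _) hx (norm_nonneg _) (abs_nonneg _)
      _ = (|Λ| + M) * ‖x + y‖ := by ring
  have hsurj : Function.Surjective G := surjective_of_strongly_monotone (by positivity) hGmono hGlip
  have hanti : ∀ p q, (c / 4) * ‖p - q‖ ≤ ‖G p - G q‖ := by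
    intro p q
    rcases (norm_nonneg (p - q)).eq_or_lt with h | h
    · rw [← h]; simp
    · have h1 := (hGmono p q).trans (real_inner_le_norm _ _)
      rw [pow_two, ← mul_assoc] at h1
      exact le_of_mul_le_mul_right h1 h
  have hinj : Function.Injective G := by
    intro p q hpq
    have := hanti p q
    rw [hpq, sub_self, norm_zero] at this
    have h2 : ‖p - q‖ = 0 := by nlinarith [norm_nonneg (p - q)]
    exact sub_eq_zero.1 (norm_eq_zero.1 h2)
  have hcont : Continuous G := by
    have : LipschitzWith ⟨|Λ| + M, by positivity⟩ G :=
      LipschitzWith.of_dist_le_mul fun p q => by rw [dist_eq_norm, dist_eq_norm]; exact hGlip p q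
    exact this.continuous
  let e₀ : E ≃ E := Equiv.ofBijective G ⟨hinj, hsurj⟩
  have hsymm : Continuous e₀.symm := by
    have : LipschitzWith ⟨(c / 4)⁻¹, by positivity⟩ e₀.symm :=
      LipschitzWith.of_dist_le_mul fun p q => by
        rw [dist_eq_norm, dist_eq_norm]
        have := hanti (e₀.symm p) (e₀.symm q)
        have e1 : ∀ z, G (e₀.symm z) = z := fun z => e₀.apply_symm_apply z
        rw [e1, e1] at this
        change _ ≤ (c / 4)⁻¹ * _
        rw [← div_eq_inv_mul, le_div_iff₀ (by positivity), mul_comm]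
        exact this
    exact this.continuous
  refine ⟨M, ⟨e₀, hcont, hsymm⟩, hMpos, fun a ha m hm => ?_⟩
  change G (a + m) = _
  have : π (a + m) = a := eq_of_add_normal_eq (hπK _) ha (hπ (a + m)) hm (by abel)
  simp only [hG, this]
  congr 2
  abel

/-! ### Convex holomorphic functions: tangent angle, support lines, Study's theorem -/

/-- A holomorphic function with nonvanishing derivative on an open set maps open subsets to open
sets. -/
theorem isOpen_image_of_deriv_ne_zero {f : ℂ → ℂ} {U V : Set ℂ} (hf : DifferentiableOn ℂ f U)
    (hU : IsOpen U) (hne : ∀ z ∈ U, deriv f z ≠ 0) (hV : IsOpen V) (hVU : V ⊆ U) :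
    IsOpen (f '' V) := by
  rw [isOpen_iff_mem_nhds]
  rintro _ ⟨z, hz, rfl⟩
  have h1 : AnalyticAt ℂ f z := hf.analyticAt (hU.mem_nhds (hVU hz))
  rw [← h1.hasStrictDerivAt.map_nhds_eq (hne z (hVU hz))]
  exact Filter.image_mem_map (hV.mem_nhds hz)

theorem circleMap_zero_mem_ball_one {r : ℝ} (hr0 : 0 ≤ r) (hr : r < 1) (θ : ℝ) :
    circleMap 0 r θ ∈ Metric.ball (0 : ℂ) 1 := by
  rw [mem_ball_zero_iff, norm_circleMap_zero, abs_of_nonneg hr0]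
  exact hr

theorem hasDerivAt_comp_circleMap {f : ℂ → ℂ} {f' : ℂ} {r θ : ℝ}
    (hf : HasDerivAt f f' (circleMap 0 r θ)) :
    HasDerivAt (fun θ : ℝ => f (circleMap 0 r θ)) (f' * (circleMap 0 r θ * Complex.I)) θ :=
  HasDerivAt.comp θ hf (hasDerivAt_circleMap 0 r θ)

/-- The tangent angle of the image of a circle under a function with `ψ' = A exp P`. -/
theorem hasDerivAt_add_im_circleMap {P : ℂ → ℂ} {p : ℂ} {r θ : ℝ}
    (hP : HasDerivAt P p (circleMap 0 r θ)) :
    HasDerivAt (fun θ : ℝ => θ + (P (circleMap 0 r θ)).im) (1 + circleMap 0 r θ * p).re θ := by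
  have h1 := (hasDerivAt_id θ).add
    (Complex.imCLM.hasFDerivAt.comp_hasDerivAt θ (hasDerivAt_comp_circleMap hP))
  refine HasDerivAt.congr_deriv h1 ?_
  simp only [Complex.imCLM_apply, Complex.add_re, Complex.one_re, Complex.mul_re, Complex.mul_im,
    Complex.I_re, Complex.I_im]
  ring

theorem strictMono_add_im_circleMap {P p : ℂ → ℂ}
    (hP : ∀ z ∈ Metric.ball (0 : ℂ) 1, HasDerivAt P (p z) z)
    (hre : ∀ z ∈ Metric.ball (0 : ℂ) 1, 0 < (1 + z * p z).re) {r : ℝ} (hr0 : 0 ≤ r) (hr : r < 1) :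
    StrictMono fun θ : ℝ => θ + (P (circleMap 0 r θ)).im :=
  strictMono_of_hasDerivAt_pos
    (fun θ => hasDerivAt_add_im_circleMap (hP _ (circleMap_zero_mem_ball_one hr0 hr θ)))
    (fun θ => hre _ (circleMap_zero_mem_ball_one hr0 hr θ))

/-- If `Re (1 + z P') > 0` in the unit disk and `P 0 = 0`, then `|Im P| ≤ π`. -/
theorem abs_im_le_pi {P p : ℂ → ℂ} (hP : ∀ z ∈ Metric.ball (0 : ℂ) 1, HasDerivAt P (p z) z)
    (hre : ∀ z ∈ Metric.ball (0 : ℂ) 1, 0 < (1 + z * p z).re) (hP0 : P 0 = 0) {z : ℂ}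
    (hz : z ∈ Metric.ball (0 : ℂ) 1) : |(P z).im| ≤ Real.pi := by
  set r := ‖z‖ with hr
  have hr0 : 0 ≤ r := norm_nonneg z
  have hr1 : r < 1 := by simpa using hz
  have hmono := (strictMono_add_im_circleMap hP hre hr0 hr1).monotone
  have hcont : Continuous fun θ : ℝ => P (circleMap 0 r θ) :=
    continuous_iff_continuousAt.2 fun θ =>
      (hasDerivAt_comp_circleMap (hP _ (circleMap_zero_mem_ball_one hr0 hr1 θ))).continuousAt
  -- Mean value property: `Im P` averages to `Im P 0 = 0` over the circle.
  have havg : ∫ θ in (0 : ℝ)..2 * Real.pi, (P (circleMap 0 r θ)).im = 0 := by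
    have h1 : Real.circleAverage P 0 r = P 0 := by
      apply DiffContOnCl.circleAverage
      apply DifferentiableOn.diffContOnCl_ball (U := Metric.ball 0 1)
      · exact fun w hw => (hP w hw).differentiableAt.differentiableWithinAt
      · rw [abs_of_nonneg hr0]; exact Metric.closedBall_subset_ball hr1
    rw [Real.circleAverage_def, hP0, smul_eq_zero] at h1
    have h2 := h1.resolve_left (by positivity)
    have h3 := Complex.imCLM.intervalIntegral_comp_comm 
      (hcont.intervalIntegrable (μ := MeasureTheory.volume) 0 (2 * Real.pi))
    simp only [Complex.imCLM_apply] at h3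
    rw [h3, h2, Complex.zero_im]
  have hper : Function.Periodic (fun θ : ℝ => (P (circleMap 0 r θ)).im) (2 * Real.pi) := fun θ => by
    simp only [periodic_circleMap 0 r θ]
  have havg' : ∀ a : ℝ, ∫ θ in a..(a + 2 * Real.pi), (P (circleMap 0 r θ)).im = 0 := fun a => by
    rw [hper.intervalIntegral_add_eq a 0, zero_add, havg]
  have hcim : Continuous fun θ : ℝ => (P (circleMap 0 r θ)).im := Complex.continuous_im.comp hcont
  have hpi := Real.pi_pos
  obtain ⟨θ₀, hθ₀⟩ : ∃ θ₀, circleMap 0 r θ₀ = z := by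
    have : z ∈ Set.range (circleMap 0 r) := by
      rw [range_circleMap, mem_sphere_zero_iff_norm, abs_of_nonneg hr0]
    exact this
  -- As `θ + Im P` increases, `Im P` lies below this line of slope `-1` on the turn ending at `θ₀`
  -- and above it on the turn starting there. The line has mean `Im P z + π` and `Im P z - π` on
  -- these turns.
  have hint : ∀ a : ℝ, ∫ θ in a..(a + 2 * Real.pi), ((P z).im - (θ - θ₀))
      = 2 * Real.pi * ((P z).im + θ₀ - a - Real.pi) := fun a => by
    rw [intervalIntegral.integral_sub (by simp)
      (Continuous.intervalIntegrable (by fun_prop) _ _),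
      intervalIntegral.integral_sub (by simp) (by simp)]
    simp
    ring
  rw [abs_le]
  constructor
  · have h1 : ∫ θ in (θ₀ - 2 * Real.pi)..(θ₀ - 2 * Real.pi + 2 * Real.pi), (P (circleMap 0 r θ)).im
        ≤ ∫ θ in (θ₀ - 2 * Real.pi)..(θ₀ - 2 * Real.pi + 2 * Real.pi), ((P z).im - (θ - θ₀)) := by
      apply intervalIntegral.integral_mono_on (by linarith) (hcim.intervalIntegrable _ _)
        (Continuous.intervalIntegrable (by fun_prop) _ _)
      intro θ hθ
      have := hmono (show θ ≤ θ₀ by linarith [hθ.2])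
      simp only [hθ₀] at this
      linarith
    rw [havg', hint] at h1
    have := nonneg_of_mul_nonneg_right h1 (by positivity)
    linarith
  · have h1 : ∫ θ in θ₀..(θ₀ + 2 * Real.pi), ((P z).im - (θ - θ₀))
        ≤ ∫ θ in θ₀..(θ₀ + 2 * Real.pi), (P (circleMap 0 r θ)).im := by
      apply intervalIntegral.integral_mono_on (by linarith)
        (Continuous.intervalIntegrable (by fun_prop) _ _) (hcim.intervalIntegrable _ _)
      intro θ hθ
      have := hmono hθ.1
      simp only [hθ₀] at this
      linarith
    rw [havg', hint] at h1
    have := nonpos_of_mul_nonpos_right h1 (by positivity)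
    linarith

/-- The image of a circle lies on one side of its tangent. -/
theorem inner_lt_zero_of_norm_eq {P p ψ : ℂ → ℂ} {A : ℂ} (hA : A ≠ 0)
    (hP : ∀ z ∈ Metric.ball (0 : ℂ) 1, HasDerivAt P (p z) z)
    (hre : ∀ z ∈ Metric.ball (0 : ℂ) 1, 0 < (1 + z * p z).re)
    (hψ : ∀ z ∈ Metric.ball (0 : ℂ) 1, HasDerivAt ψ (A * Complex.exp (P z)) z) {z w : ℂ}
    (hz : z ∈ Metric.ball (0 : ℂ) 1) (hz0 : z ≠ 0) (hw : ‖w‖ = ‖z‖) (hwz : w ≠ z) :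
    inner ℝ (z * (A * Complex.exp (P z))) (ψ w - ψ z) < 0 := by
  set r := ‖z‖ with hr
  have hr0 : 0 < r := norm_pos_iff.2 hz0
  have hr1 : r < 1 := by simpa using hz
  have hmem := circleMap_zero_mem_ball_one hr0.le hr1
  set Θ : ℝ → ℝ := fun θ => θ + (P (circleMap 0 r θ)).im with hΘ
  have hmono : StrictMono Θ := strictMono_add_im_circleMap hP hre hr0.le hr1
  have hΘc : Continuous Θ := continuous_iff_continuousAt.2 fun θ =>
    (hasDerivAt_add_im_circleMap (hP _ (hmem θ))).continuousAt
  have hpi := Real.pi_pos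
  obtain ⟨θ₀, hθ₀⟩ : ∃ θ₀, circleMap 0 r θ₀ = z := by
    have : z ∈ Set.range (circleMap 0 r) := by
      rw [range_circleMap, mem_sphere_zero_iff_norm, abs_of_pos hr0]
    exact this
  obtain ⟨θ, hθI, hθ⟩ : ∃ θ ∈ Set.Ico θ₀ (θ₀ + 2 * Real.pi), circleMap 0 r θ = w := by
    have : w ∈ Set.range (circleMap 0 r) := by
      rw [range_circleMap, mem_sphere_zero_iff_norm, abs_of_pos hr0, hw]
    obtain ⟨t, rfl⟩ := this
    obtain ⟨y, hy, h⟩ := (periodic_circleMap 0 r).exists_mem_Ico (by positivity) t θ₀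
    exact ⟨y, hy, h.symm⟩
  have hlt : θ₀ < θ := lt_of_le_of_ne hθI.1 fun h => hwz (by rw [← hθ, ← hθ₀, h])
  set V : ℂ := z * (A * Complex.exp (P z)) with hV
  set u : ℝ → ℝ := fun θ => inner ℝ V (ψ (circleMap 0 r θ)) with hu
  -- `V` is the outward normal at `z`, so the tangent at `t` makes the angle `Θ t - Θ θ₀ + π / 2`
  -- with it, whence the factor `-sin`.
  have hu' : ∀ t, HasDerivAt u (-(‖A‖ ^ 2 * r ^ 2 * Real.exp ((P (circleMap 0 r t)).re + (P z).re)
      * Real.sin (Θ t - Θ θ₀))) t := by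
    intro t
    have h1 := (innerSL ℝ V).hasFDerivAt.comp_hasDerivAt t
      (hasDerivAt_comp_circleMap (hψ _ (hmem t)))
    refine HasDerivAt.congr_deriv h1 ?_
    rw [innerSL_apply_apply, Complex.inner, mul_comm]
    have e1 : (starRingEnd ℂ) V = (r : ℂ) * Complex.exp (-(θ₀ * Complex.I)) *
        ((starRingEnd ℂ) A * Complex.exp ((P z).re - (P z).im * Complex.I)) := by
      rw [hV]
      nth_rewrite 1 [← hθ₀]
      simp only [circleMap, map_mul, ← Complex.exp_conj, zero_add, Complex.conj_ofReal,
        Complex.conj_I, mul_neg]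
      congr 3
      apply Complex.ext <;> simp
    have e2 : (starRingEnd ℂ) V * (A * Complex.exp (P (circleMap 0 r t)) *
        (circleMap 0 r t * Complex.I)) =
        ((‖A‖ ^ 2 * r ^ 2 * Real.exp ((P (circleMap 0 r t)).re + (P z).re) : ℝ) : ℂ) *
          (Complex.exp (((Θ t - Θ θ₀ : ℝ) : ℂ) * Complex.I) * Complex.I) := by
      rw [e1]
      have e3 : Complex.exp (P (circleMap 0 r t)) = Complex.exp ((P (circleMap 0 r t)).re +
          (P (circleMap 0 r t)).im * Complex.I) := by rw [Complex.re_add_im]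
      rw [e3]
      nth_rewrite 3 [circleMap]
      rw [zero_add]
      have e4 : (starRingEnd ℂ) A * A = ((‖A‖ ^ 2 : ℝ) : ℂ) := by
        rw [Complex.conj_mul']; push_cast; rfl
      push_cast at e4 ⊢
      rw [← e4]
      have e5 : Complex.exp (-(θ₀ * Complex.I)) * Complex.exp ((P z).re - (P z).im * Complex.I) *
          Complex.exp ((P (circleMap 0 r t)).re + (P (circleMap 0 r t)).im * Complex.I) *
          Complex.exp (t * Complex.I) = Complex.exp ((P (circleMap 0 r t)).re + (P z).re) *
          Complex.exp (((Θ t : ℂ) - Θ θ₀) * Complex.I) := by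
        simp only [← Complex.exp_add, hΘ, hθ₀]
        congr 1
        push_cast
        ring
      linear_combination (r : ℂ) ^ 2 * ((starRingEnd ℂ) A * A) * Complex.I * e5
    rw [e2, Complex.re_ofReal_mul, Complex.mul_I_re, Complex.exp_ofReal_mul_I_im]
    ring
  have huc : Continuous u := continuous_iff_continuousAt.2 fun t => (hu' t).continuousAt
  have hend : Θ (θ₀ + 2 * Real.pi) = Θ θ₀ + 2 * Real.pi := by
    simp only [hΘ, periodic_circleMap 0 r θ₀]; ring
  have hpos : ∀ t, 0 < ‖A‖ ^ 2 * r ^ 2 * Real.exp ((P (circleMap 0 r t)).re + (P z).re) :=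
    fun t => by have := norm_pos_iff.2 hA; positivity
  -- At `s` the tangent has turned by `π`: `u` strictly decreases up to `s`, then strictly increases
  -- back to `u θ₀` after a full turn.
  obtain ⟨s, hsI, hs⟩ := intermediate_value_Icc (show θ₀ ≤ θ₀ + 2 * Real.pi by linarith)
    hΘc.continuousOn (show Θ θ₀ + Real.pi ∈ Set.Icc (Θ θ₀) (Θ (θ₀ + 2 * Real.pi)) by
      rw [hend]; constructor <;> linarith)
  have huz : u θ < u θ₀ := by
    rcases le_or_gt θ s with h | h
    · have hanti : StrictAntiOn u (Set.Icc θ₀ s) := by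
        apply strictAntiOn_of_deriv_neg (convex_Icc _ _) huc.continuousOn
        intro t ht
        rw [interior_Icc] at ht
        rw [(hu' t).deriv]
        have h1 := hmono ht.1
        have h2 := hmono ht.2
        have := Real.sin_pos_of_pos_of_lt_pi (x := Θ t - Θ θ₀) (by linarith) (by linarith)
        have := mul_pos (hpos t) this
        linarith
      exact hanti ⟨le_rfl, hsI.1⟩ ⟨hlt.le, h⟩ hlt
    · have hm : StrictMonoOn u (Set.Icc s (θ₀ + 2 * Real.pi)) := by
        apply strictMonoOn_of_deriv_pos (convex_Icc _ _) huc.continuousOn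
        intro t ht
        rw [interior_Icc] at ht
        rw [(hu' t).deriv]
        have h1 := hmono ht.1
        have h2 := hmono ht.2
        have := Real.sin_pos_of_pos_of_lt_pi (x := Θ t - Θ θ₀ - Real.pi) (by linarith)
          (by linarith)
        rw [Real.sin_sub_pi] at this
        have := mul_pos (hpos t) this
        linarith
      have h1 := hm ⟨h.le, hθI.2.le⟩ ⟨hsI.2, le_rfl⟩ hθI.2
      have h2 : u (θ₀ + 2 * Real.pi) = u θ₀ := by simp only [hu, periodic_circleMap 0 r θ₀]
      linarith
  simp only [hu, hθ, hθ₀] at huz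
  rw [inner_sub_right]
  linarith

/-- The image of a disk lies on one side of the tangent at each point of the image of the bounding
circle. -/
theorem inner_lt_zero_of_norm_le {P p ψ : ℂ → ℂ} {A : ℂ} (hA : A ≠ 0)
    (hP : ∀ z ∈ Metric.ball (0 : ℂ) 1, HasDerivAt P (p z) z)
    (hre : ∀ z ∈ Metric.ball (0 : ℂ) 1, 0 < (1 + z * p z).re)
    (hψ : ∀ z ∈ Metric.ball (0 : ℂ) 1, HasDerivAt ψ (A * Complex.exp (P z)) z) {z w : ℂ}
    (hz : z ∈ Metric.ball (0 : ℂ) 1) (hz0 : z ≠ 0) (hw : ‖w‖ ≤ ‖z‖) (hwz : w ≠ z) :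
    inner ℝ (z * (A * Complex.exp (P z))) (ψ w - ψ z) < 0 := by
  rcases hw.eq_or_lt with h | h
  · exact inner_lt_zero_of_norm_eq hA hP hre hψ hz hz0 h hwz
  set V : ℂ := z * (A * Complex.exp (P z)) with hV
  have hz1 : ‖z‖ < 1 := by simpa using hz
  have hV0 : V ≠ 0 := mul_ne_zero hz0 (mul_ne_zero hA (Complex.exp_ne_zero _))
  have hdiff : DifferentiableOn ℂ ψ (Metric.ball 0 1) :=
    fun w hw => (hψ w hw).differentiableAt.differentiableWithinAt
  have hle : ∀ x ∈ Metric.ball (0 : ℂ) ‖z‖, inner ℝ V (ψ x) ≤ inner ℝ V (ψ z) := by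
    intro x hx
    -- Exponentiating turns the linear functional into a modulus, to which the maximum principle
    -- applies.
    have hn : ∀ y, ‖Complex.exp ((starRingEnd ℂ) V * ψ y)‖ = Real.exp (inner ℝ V (ψ y)) := by
      intro y
      rw [Complex.norm_exp, Complex.inner, mul_comm]
    have h1 : ‖Complex.exp ((starRingEnd ℂ) V * ψ x)‖ ≤ Real.exp (inner ℝ V (ψ z)) := by
      refine Complex.norm_le_of_forall_mem_frontier_norm_le (U := Metric.ball 0 ‖z‖)
        (f := fun y => Complex.exp ((starRingEnd ℂ) V * ψ y))
        Metric.isBounded_ball ?_ ?_ (subset_closure hx)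
      · exact DifferentiableOn.diffContOnCl_ball (U := Metric.ball 0 1)
          ((hdiff.const_mul _).cexp) (Metric.closedBall_subset_ball hz1)
      · intro y hy
        rw [frontier_ball _ (norm_ne_zero_iff.2 hz0), mem_sphere_zero_iff_norm] at hy
        simp only [hn]
        rw [Real.exp_le_exp]
        by_cases hyz : y = z
        · rw [hyz]
        · have := inner_lt_zero_of_norm_eq hA hP hre hψ hz hz0 hy hyz
          rw [inner_sub_right] at this
          linarith
    rw [hn, Real.exp_le_exp] at h1
    exact h1
  -- Strictness: the image of the open disk is open, so from `ψ w` one can move a little along `V`,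
  -- which equality would not allow.
  have hopen : IsOpen (ψ '' Metric.ball 0 ‖z‖) :=
    isOpen_image_of_deriv_ne_zero hdiff Metric.isOpen_ball
      (fun x hx => by rw [(hψ x hx).deriv]; exact mul_ne_zero hA (Complex.exp_ne_zero _))
      Metric.isOpen_ball (Metric.ball_subset_ball hz1.le)
  have hmem : ψ w ∈ ψ '' Metric.ball 0 ‖z‖ := ⟨w, by simpa using h, rfl⟩
  have hcont : Filter.Tendsto (fun t : ℝ => ψ w + t • V) (nhdsWithin 0 (Set.Ioi 0))
      (nhds (ψ w)) := by
    have : Continuous fun t : ℝ => ψ w + t • V := by fun_prop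
    have h2 := this.tendsto 0
    simp only [zero_smul, add_zero] at h2
    exact h2.mono_left nhdsWithin_le_nhds
  obtain ⟨t, ht, ht0⟩ := ((hcont.eventually (hopen.mem_nhds hmem)).and self_mem_nhdsWithin).exists
  obtain ⟨x, hx, hxe⟩ := ht
  have h3 := hle x hx
  rw [hxe, inner_add_right, inner_smul_right, real_inner_self_eq_norm_sq] at h3
  have h4 : 0 < t * ‖V‖ ^ 2 := mul_pos ht0 (pow_pos (norm_pos_iff.2 hV0) 2)
  rw [inner_sub_right]
  linarith

/-- Were two images equal, the support inequality at the point of larger modulus would read `0 < 0`.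
-/
theorem injOn_of_convexity {P p ψ : ℂ → ℂ} {A : ℂ} (hA : A ≠ 0)
    (hP : ∀ z ∈ Metric.ball (0 : ℂ) 1, HasDerivAt P (p z) z)
    (hre : ∀ z ∈ Metric.ball (0 : ℂ) 1, 0 < (1 + z * p z).re)
    (hψ : ∀ z ∈ Metric.ball (0 : ℂ) 1, HasDerivAt ψ (A * Complex.exp (P z)) z) :
    Set.InjOn ψ (Metric.ball 0 1) := by
  have key : ∀ z ∈ Metric.ball (0 : ℂ) 1, ∀ w, ‖w‖ ≤ ‖z‖ → ψ z = ψ w → z = w := by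
    intro z hz w hw h
    by_contra hne
    have hz0 : z ≠ 0 := by
      rintro rfl
      rw [norm_zero] at hw
      exact hne (norm_le_zero_iff.1 hw).symm
    have := inner_lt_zero_of_norm_le hA hP hre hψ hz hz0 hw (Ne.symm hne)
    rw [h, sub_self, inner_zero_right] at this
    exact lt_irrefl _ this
  intro z hz w hw h
  rcases le_total ‖w‖ ‖z‖ with h1 | h1
  · exact key z hz w h1 h
  · exact (key w hw z h1 h.symm).symm

/-- Study's theorem: the image of a disk is convex. -/
theorem convex_image_ball {P p ψ : ℂ → ℂ} {A : ℂ} (hA : A ≠ 0)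
    (hP : ∀ z ∈ Metric.ball (0 : ℂ) 1, HasDerivAt P (p z) z)
    (hre : ∀ z ∈ Metric.ball (0 : ℂ) 1, 0 < (1 + z * p z).re)
    (hψ : ∀ z ∈ Metric.ball (0 : ℂ) 1, HasDerivAt ψ (A * Complex.exp (P z)) z) {r : ℝ}
    (hr0 : 0 < r) (hr1 : r < 1) : Convex ℝ (ψ '' Metric.ball 0 r) := by
  have hdiff : DifferentiableOn ℂ ψ (Metric.ball 0 1) :=
    fun w hw => (hψ w hw).differentiableAt.differentiableWithinAt
  -- `C` is the intersection of the open tangent half-planes. The image is open, and its closure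
  -- adds only images of the circle, each on its own tangent line and so outside `C`; connectedness
  -- of `C` forces equality.
  set C : Set ℂ := ⋂ z ∈ Metric.sphere (0 : ℂ) r,
    {w | inner ℝ (z * (A * Complex.exp (P z))) w < inner ℝ (z * (A * Complex.exp (P z))) (ψ z)}
    with hC
  have hCconv : Convex ℝ C := convex_iInter₂ fun z _ =>
    convex_halfSpace_lt (innerSL ℝ (z * (A * Complex.exp (P z)))).toLinearMap.isLinear _
  have hopen : IsOpen (ψ '' Metric.ball 0 r) :=
    isOpen_image_of_deriv_ne_zero hdiff Metric.isOpen_ball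
      (fun x hx => by rw [(hψ x hx).deriv]; exact mul_ne_zero hA (Complex.exp_ne_zero _))
      Metric.isOpen_ball (Metric.ball_subset_ball hr1.le)
  have hsub : ψ '' Metric.ball 0 r ⊆ C := by
    rintro _ ⟨w, hw, rfl⟩
    rw [mem_ball_zero_iff] at hw
    refine Set.mem_iInter₂.2 fun z hz => ?_
    rw [mem_sphere_zero_iff_norm] at hz
    have := inner_lt_zero_of_norm_le hA hP hre hψ (z := z) (w := w) (by simpa [hz] using hr1)
      (by rintro rfl; simp at hz; linarith) (by rw [hz]; exact hw.le)
      (by rintro rfl; linarith)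
    rw [inner_sub_right] at this
    change inner ℝ _ _ < _
    linarith
  have hcl : closure (ψ '' Metric.ball 0 r) ⊆ ψ '' Metric.closedBall 0 r := by
    refine closure_minimal (Set.image_mono Metric.ball_subset_closedBall) ?_
    exact ((isCompact_closedBall 0 r).image_of_continuousOn
      (hdiff.continuousOn.mono (Metric.closedBall_subset_ball hr1))).isClosed
  have hCsub : C ⊆ ψ '' Metric.ball 0 r := by
    refine hCconv.isPreconnected.subset_of_closure_inter_subset hopen ?_ ?_
    · have : ψ 0 ∈ ψ '' Metric.ball 0 r := ⟨0, by simpa using hr0, rfl⟩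
      exact ⟨ψ 0, hsub this, this⟩
    · rintro _ ⟨hw1, hw2⟩
      obtain ⟨z, hz, rfl⟩ := hcl hw1
      rw [mem_closedBall_zero_iff] at hz
      rcases hz.eq_or_lt with h | h
      · have := Set.mem_iInter₂.1 hw2 z (by simpa using h)
        exact absurd (show inner ℝ _ _ < inner ℝ _ _ from this) (lt_irrefl _)
      · exact ⟨z, by simpa using h, rfl⟩
  rw [hsub.antisymm hCsub]
  exact hCconv

/-! ### The harmonic map in the convex coordinate -/

/-- A harmonic function `H + conj G` on a convex set with `Re H' - |G'| ≥ c` is strongly monotone,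
and it is Lipschitz if `|H'| + |G'|` is bounded. -/
theorem strongly_monotone_add_conj {H G H' G' : ℂ → ℂ} {Ω : Set ℂ} (hΩ : Convex ℝ Ω)
    (hH : ∀ w ∈ Ω, HasDerivAt H (H' w) w) (hG : ∀ w ∈ Ω, HasDerivAt G (G' w) w) {c Λ : ℝ}
    (hc : ∀ w ∈ Ω, c ≤ (H' w).re - ‖G' w‖) (hΛ : ∀ w ∈ Ω, ‖H' w‖ + ‖G' w‖ ≤ Λ) {a b : ℂ}
    (ha : a ∈ Ω) (hb : b ∈ Ω) :
    c * ‖a - b‖ ^ 2 ≤ inner ℝ (H a + (starRingEnd ℂ) (G a) - (H b + (starRingEnd ℂ) (G b))) (a - b) ∧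
    ‖H a + (starRingEnd ℂ) (G a) - (H b + (starRingEnd ℂ) (G b))‖ ≤ Λ * ‖a - b‖ := by
  set γ : ℝ → ℂ := fun t => b + t * (a - b) with hγ
  have hγmem : ∀ t ∈ Set.Icc (0 : ℝ) 1, γ t ∈ Ω := fun t ht => by
    have := hΩ.add_smul_sub_mem hb ha ht
    simpa [hγ] using this
  have hγ' : ∀ t, HasDerivAt γ (a - b) t := fun t => by
    have := ((Complex.ofRealCLM.hasDerivAt (x := t)).mul_const (a - b)).const_add b
    simpa [hγ] using this
  set F : ℝ → ℂ := fun t => H (γ t) + (starRingEnd ℂ) (G (γ t)) with hF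
  have hF' : ∀ t ∈ Set.Icc (0 : ℝ) 1, HasDerivAt F
      (H' (γ t) * (a - b) + (starRingEnd ℂ) (G' (γ t) * (a - b))) t := fun t ht => by
    have h1 : HasDerivAt (fun t => H (γ t)) _ t := (hH _ (hγmem t ht)).comp t (hγ' t)
    have h2 : HasDerivAt (fun t => G (γ t)) _ t := (hG _ (hγmem t ht)).comp t (hγ' t)
    have h3 := Complex.conjCLE.toContinuousLinearMap.hasFDerivAt.comp_hasDerivAt t h2
    exact h1.add h3
  have hF1 : F 1 = H a + (starRingEnd ℂ) (G a) := by simp [hF, hγ]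
  have hF0 : F 0 = H b + (starRingEnd ℂ) (G b) := by simp [hF, hγ]
  rw [← hF1, ← hF0]
  constructor
  · set u : ℝ → ℝ := fun t => inner ℝ (a - b) (F t) with hu
    have hu' : ∀ t ∈ Set.Icc (0 : ℝ) 1, HasDerivAt u
        (inner ℝ (a - b) (H' (γ t) * (a - b) + (starRingEnd ℂ) (G' (γ t) * (a - b)))) t :=
      fun t ht => (innerSL ℝ (a - b)).hasFDerivAt.comp_hasDerivAt t (hF' t ht)
    have h1 := (convex_Icc (0 : ℝ) 1).mul_sub_le_image_sub_of_le_deriv (f := u)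
      (fun t ht => (hu' t ht).continuousAt.continuousWithinAt)
      (fun t ht => (hu' t (interior_subset ht)).differentiableAt.differentiableWithinAt)
      (C := c * ‖a - b‖ ^ 2) (fun t ht => by
        rw [(hu' t (interior_subset ht)).deriv, inner_add_right]
        have hm := hγmem t (interior_subset ht)
        have e1 : inner ℝ (a - b) (H' (γ t) * (a - b)) = (H' (γ t)).re * ‖a - b‖ ^ 2 := by
          rw [Complex.inner, mul_assoc, Complex.mul_conj', ← Complex.ofReal_pow,
            Complex.re_mul_ofReal]
        have e2 : -(‖G' (γ t)‖ * ‖a - b‖ ^ 2) ≤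
            inner ℝ (a - b) ((starRingEnd ℂ) (G' (γ t) * (a - b))) := by
          have := abs_real_inner_le_norm (a - b) ((starRingEnd ℂ) (G' (γ t) * (a - b)))
          rw [RCLike.norm_conj, norm_mul] at this
          have h4 := neg_abs_le (inner ℝ (a - b) ((starRingEnd ℂ) (G' (γ t) * (a - b))))
          nlinarith
        have := mul_le_mul_of_nonneg_right (hc _ hm) (sq_nonneg ‖a - b‖)
        linarith) 0 (by simp) 1 (by simp) zero_le_one
    simp only [hu] at h1
    rw [real_inner_comm, inner_sub_right]
    linarith
  · have h1 := (convex_Icc (0 : ℝ) 1).norm_image_sub_le_of_norm_hasDerivWithin_le (f := F)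
      (C := Λ * ‖a - b‖) (fun t ht => (hF' t ht).hasDerivWithinAt) (fun t ht => by
        refine (norm_add_le _ _).trans ?_
        rw [RCLike.norm_conj, norm_mul, norm_mul, ← add_mul]
        exact mul_le_mul_of_nonneg_right (hΛ _ (hγmem t ht)) (norm_nonneg _))
      (show (0 : ℝ) ∈ Set.Icc (0 : ℝ) 1 by simp) (show (1 : ℝ) ∈ Set.Icc (0 : ℝ) 1 by simp)
    simpa using h1

/-- The derivative of a holomorphic function read in the coordinate of an injective holomorphic
function. -/
theorem hasDerivAt_comp_invFunOn {ψ h D q : ℂ → ℂ} {U : Set ℂ} (hU : IsOpen U)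
    (hψ : ∀ z ∈ U, HasDerivAt ψ (D z) z) (hD : ∀ z ∈ U, D z ≠ 0) (hinj : Set.InjOn ψ U)
    (hh : ∀ z ∈ U, HasDerivAt h (q z) z) {z : ℂ} (hz : z ∈ U) :
    HasDerivAt (fun w => h (Function.invFunOn ψ U w)) (q z / D z) (ψ z) := by
  set κ := Function.invFunOn ψ U with hκ
  have hleft : ∀ x ∈ U, κ (ψ x) = x := fun x hx => hinj.leftInvOn_invFunOn hx
  have hopen : ∀ V ⊆ U, IsOpen V → IsOpen (ψ '' V) := fun V hV hVo =>
    isOpen_image_of_deriv_ne_zero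
      (fun x hx => (hψ x hx).differentiableAt.differentiableWithinAt) hU
      (fun x hx => by rw [(hψ x hx).deriv]; exact hD x hx) hVo hV
  have hcont : ContinuousAt κ (ψ z) := by
    rw [ContinuousAt, hleft z hz]
    intro V hV
    obtain ⟨W, hW, hWo, hzW⟩ := mem_nhds_iff.1 (Filter.inter_mem hV (hU.mem_nhds hz))
    rw [Filter.mem_map]
    refine Filter.mem_of_superset ((hopen W (fun x hx => (hW hx).2) hWo).mem_nhds ⟨z, hzW, rfl⟩) ?_
    rintro _ ⟨x, hx, rfl⟩
    change κ (ψ x) ∈ V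
    rw [hleft x (hW hx).2]
    exact (hW hx).1
  have hright : ∀ᶠ w in nhds (ψ z), ψ (κ w) = w := by
    filter_upwards [(hopen U subset_rfl hU).mem_nhds ⟨z, hz, rfl⟩] with w hw
    exact Function.invFunOn_eq hw
  have hκ' : HasDerivAt κ (D z)⁻¹ (ψ z) :=
    HasDerivAt.of_local_left_inverse hcont (by rw [hleft z hz]; exact hψ z hz) (hD z hz) hright
  rw [div_eq_mul_inv]
  refine HasDerivAt.comp (ψ z) ?_ hκ'
  rw [hleft z hz]
  exact hh z hz

/-- A vector normal at a boundary point to the image of a disk under `ψ` is a nonnegative multiple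
of `z ψ'(z)`. -/
theorem exists_eq_smul_of_normal {ψ : ℂ → ℂ} {d z m : ℂ} (hψ : HasDerivAt ψ d z) (hd : z * d ≠ 0)
    (h0 : inner ℝ (z * d) (ψ 0 - ψ z) < 0)
    (hm : ∀ x ∈ Metric.closedBall (0 : ℂ) ‖z‖, inner ℝ m (ψ x - ψ z) ≤ 0) :
    ∃ t : ℝ, 0 ≤ t ∧ m = t • (z * d) := by
  obtain ⟨θ₀, hθ₀⟩ : ∃ θ₀, circleMap 0 ‖z‖ θ₀ = z := by
    have : z ∈ Set.range (circleMap 0 ‖z‖) := by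
      rw [range_circleMap, mem_sphere_zero_iff_norm, abs_of_nonneg (norm_nonneg z)]
    exact this
  -- The first-order condition along the circle makes `m` orthogonal to the tangent, hence a real
  -- multiple of `z * d`; the interior value `ψ 0` fixes the sign.
  have hmax : IsLocalMax (fun θ : ℝ => inner ℝ m (ψ (circleMap 0 ‖z‖ θ))) θ₀ := by
    refine Filter.Eventually.of_forall fun θ => ?_
    have := hm (circleMap 0 ‖z‖ θ) (circleMap_mem_closedBall 0 (norm_nonneg z) θ)
    rw [inner_sub_right] at this
    simp only [hθ₀]
    linarith
  have hder := (innerSL ℝ m).hasFDerivAt.comp_hasDerivAt θ₀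
    (hasDerivAt_comp_circleMap (by rw [hθ₀]; exact hψ))
  have hzero := hmax.hasDerivAt_eq_zero hder
  obtain ⟨q, rfl⟩ : ∃ q, m = q * (z * d) := ⟨m / (z * d), (div_mul_cancel₀ m hd).symm⟩
  rw [innerSL_apply_apply, hθ₀] at hzero
  have hq : q.im = 0 := by
    have e : inner ℝ (q * (z * d)) (d * (z * Complex.I)) = q.im * ‖z * d‖ ^ 2 := by
      rw [Complex.inner, map_mul, show d * (z * Complex.I) * ((starRingEnd ℂ) q *
        (starRingEnd ℂ) (z * d)) = (z * d * (starRingEnd ℂ) (z * d)) *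
          (Complex.I * (starRingEnd ℂ) q) by ring, Complex.mul_conj', ← Complex.ofReal_pow,
        Complex.re_ofReal_mul]
      simp
      ring
    rw [e] at hzero
    exact (mul_eq_zero.1 hzero).resolve_right (pow_ne_zero 2 (norm_ne_zero_iff.2 hd))
  have hqr : q * (z * d) = q.re • (z * d) := by
    rw [Complex.real_smul]
    congr 1
    apply Complex.ext <;> simp [hq]
  refine ⟨q.re, ?_, hqr⟩
  have h1 := hm 0 (by simp)
  rw [hqr, real_inner_smul_left] at h1
  by_contra hneg
  have := mul_pos_of_neg_of_neg (not_le.1 hneg) h0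
  linarith

/-- If `ψ` is convex and `|g'/ψ'| < Re (h'/ψ')` on a closed disk, then `h + conj g` is injective in
the open disk and maps it onto a close-to-convex domain. -/
theorem isCloseToConvexDomain_image_ball {P p ψ h g : ℂ → ℂ} {A : ℂ} (hA : A ≠ 0)
    (hP : ∀ z ∈ Metric.ball (0 : ℂ) 1, HasDerivAt P (p z) z)
    (hre : ∀ z ∈ Metric.ball (0 : ℂ) 1, 0 < (1 + z * p z).re)
    (hψ : ∀ z ∈ Metric.ball (0 : ℂ) 1, HasDerivAt ψ (A * Complex.exp (P z)) z)
    (hh : DifferentiableOn ℂ h (Metric.ball 0 1)) (hg : DifferentiableOn ℂ g (Metric.ball 0 1))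
    {r : ℝ} (hr0 : 0 < r) (hr1 : r < 1)
    (hlt : ∀ z ∈ Metric.closedBall (0 : ℂ) r, ‖deriv g z / (A * Complex.exp (P z))‖ <
      (deriv h z / (A * Complex.exp (P z))).re) :
    Set.InjOn (fun z => h z + (starRingEnd ℂ) (g z)) (Metric.ball 0 r) ∧
      IsCloseToConvexDomain ((fun z => h z + (starRingEnd ℂ) (g z)) '' Metric.ball 0 r) := by
  set D : ℂ → ℂ := fun z => A * Complex.exp (P z) with hD
  set f : ℂ → ℂ := fun z => h z + (starRingEnd ℂ) (g z) with hf
  have hDne : ∀ z, D z ≠ 0 := fun z => mul_ne_zero hA (Complex.exp_ne_zero _)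
  have hB1 : Metric.closedBall (0 : ℂ) r ⊆ Metric.ball 0 1 := Metric.closedBall_subset_ball hr1
  have hBB : Metric.ball (0 : ℂ) r ⊆ Metric.closedBall 0 r := Metric.ball_subset_closedBall
  have hdiff : DifferentiableOn ℂ ψ (Metric.ball 0 1) :=
    fun w hw => (hψ w hw).differentiableAt.differentiableWithinAt
  have hψc : ContinuousOn ψ (Metric.closedBall 0 r) := hdiff.continuousOn.mono hB1
  have hfc : ContinuousOn f (Metric.closedBall 0 r) :=
    (hh.continuousOn.mono hB1).add
      (Complex.continuous_conj.comp_continuousOn (hg.continuousOn.mono hB1))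
  have hDc : ContinuousOn D (Metric.closedBall 0 r) := fun z hz =>
    ((hP z (hB1 hz)).continuousAt.cexp.const_mul A).continuousWithinAt
  have hqc : ContinuousOn (fun z => deriv h z / D z) (Metric.closedBall 0 r) :=
    ((hh.deriv Metric.isOpen_ball).continuousOn.mono hB1).div hDc fun z _ => hDne z
  have hsc : ContinuousOn (fun z => deriv g z / D z) (Metric.closedBall 0 r) :=
    ((hg.deriv Metric.isOpen_ball).continuousOn.mono hB1).div hDc fun z _ => hDne z
  have hne : (Metric.closedBall (0 : ℂ) r).Nonempty := ⟨0, by simpa using hr0.le⟩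
  -- Compactness of the closed disk makes the strict inequality uniform.
  obtain ⟨c, hc0, hc⟩ : ∃ c : ℝ, 0 < c ∧ ∀ z ∈ Metric.closedBall (0 : ℂ) r,
      c ≤ (deriv h z / D z).re - ‖deriv g z / D z‖ := by
    obtain ⟨z, hz, hmin⟩ := (isCompact_closedBall (0 : ℂ) r).exists_isMinOn hne
      ((Complex.continuous_re.comp_continuousOn hqc).sub hsc.norm)
    exact ⟨_, sub_pos.2 (hlt z hz), fun w hw => hmin hw⟩
  obtain ⟨Λ, hΛ⟩ : ∃ Λ : ℝ, ∀ z ∈ Metric.closedBall (0 : ℂ) r,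
      ‖deriv h z / D z‖ + ‖deriv g z / D z‖ ≤ Λ := by
    obtain ⟨z, hz, hmax⟩ := (isCompact_closedBall (0 : ℂ) r).exists_isMaxOn hne
      (hqc.norm.add hsc.norm)
    exact ⟨_, fun w hw => hmax hw⟩
  have hinj := injOn_of_convexity hA hP hre hψ
  have hO : IsOpen (ψ '' Metric.ball 0 r) :=
    isOpen_image_of_deriv_ne_zero hdiff Metric.isOpen_ball
      (fun x hx => by rw [(hψ x hx).deriv]; exact hDne x)
      Metric.isOpen_ball (Metric.ball_subset_ball hr1.le)
  have hOconv : Convex ℝ (ψ '' Metric.ball 0 r) := convex_image_ball hA hP hre hψ hr0 hr1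
  set K : Set ℂ := ψ '' Metric.closedBall 0 r with hK
  have hKcl : IsClosed K := ((isCompact_closedBall 0 r).image_of_continuousOn hψc).isClosed
  have hKclos : closure (ψ '' Metric.ball 0 r) = K := by
    refine (closure_minimal (Set.image_mono hBB) hKcl).antisymm ?_
    rw [← closure_ball (0 : ℂ) hr0.ne']
    exact ContinuousOn.image_closure (by rwa [closure_ball (0 : ℂ) hr0.ne'])
  have hKconv : Convex ℝ K := hKclos ▸ hOconv.closure
  -- the inequalities in the open disk, then by continuity in the closed disk
  have hball : ∀ x ∈ Metric.ball (0 : ℂ) r ×ˢ Metric.ball (0 : ℂ) r,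
      c * ‖ψ x.1 - ψ x.2‖ ^ 2 ≤ inner ℝ (f x.1 - f x.2) (ψ x.1 - ψ x.2) ∧
      ‖f x.1 - f x.2‖ ≤ Λ * ‖ψ x.1 - ψ x.2‖ := by
    rintro ⟨z, w⟩ ⟨hz, hw⟩
    set κ := Function.invFunOn ψ (Metric.ball 0 r) with hκ
    have hinjr : Set.InjOn ψ (Metric.ball 0 r) := hinj.mono (hBB.trans hB1)
    have hleft : ∀ x ∈ Metric.ball (0 : ℂ) r, κ (ψ x) = x :=
      fun x hx => hinjr.leftInvOn_invFunOn hx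
    have hd : ∀ k : ℂ → ℂ, DifferentiableOn ℂ k (Metric.ball 0 1) → ∀ y ∈ ψ '' Metric.ball 0 r,
        HasDerivAt (fun y => k (κ y)) (deriv k (κ y) / D (κ y)) y := by
      rintro k hk _ ⟨x, hx, rfl⟩
      have := hasDerivAt_comp_invFunOn (h := k) (q := deriv k) Metric.isOpen_ball
        (fun x hx => hψ x (hB1 (hBB hx)))
        (fun x _ => hDne x) hinjr (fun x hx => (hk.differentiableAt
          (Metric.isOpen_ball.mem_nhds (hB1 (hBB hx)))).hasDerivAt) hx
      rw [hleft x hx]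
      exact this
    have := strongly_monotone_add_conj hOconv (hd h hh) (hd g hg) (c := c) (Λ := Λ)
      (by rintro _ ⟨x, hx, rfl⟩; rw [hleft x hx]; exact hc x (hBB hx))
      (by rintro _ ⟨x, hx, rfl⟩; rw [hleft x hx]; exact hΛ x (hBB hx))
      (Set.mem_image_of_mem ψ hz) (Set.mem_image_of_mem ψ hw)
    rwa [hleft z hz, hleft w hw] at this
  have hclosprod : closure (Metric.ball (0 : ℂ) r ×ˢ Metric.ball (0 : ℂ) r) =
      Metric.closedBall 0 r ×ˢ Metric.closedBall 0 r := by
    rw [closure_prod_eq, closure_ball (0 : ℂ) hr0.ne']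
  have hψ1 : ContinuousOn (fun x : ℂ × ℂ => ψ x.1 - ψ x.2)
      (closure (Metric.ball (0 : ℂ) r ×ˢ Metric.ball (0 : ℂ) r)) := by
    rw [hclosprod]
    exact (hψc.comp continuousOn_fst fun x hx => hx.1).sub
      (hψc.comp continuousOn_snd fun x hx => hx.2)
  have hf1 : ContinuousOn (fun x : ℂ × ℂ => f x.1 - f x.2)
      (closure (Metric.ball (0 : ℂ) r ×ˢ Metric.ball (0 : ℂ) r)) := by
    rw [hclosprod]
    exact (hfc.comp continuousOn_fst fun x hx => hx.1).sub
      (hfc.comp continuousOn_snd fun x hx => hx.2)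
  have hmono : ∀ z ∈ Metric.closedBall (0 : ℂ) r, ∀ w ∈ Metric.closedBall (0 : ℂ) r,
      c * ‖ψ z - ψ w‖ ^ 2 ≤ inner ℝ (f z - f w) (ψ z - ψ w) := fun z hz w hw =>
    le_on_closure (fun x hx => (hball x hx).1) ((hψ1.norm.pow 2).const_mul c) (hf1.inner hψ1)
      (x := (z, w)) (by rw [hclosprod]; exact ⟨hz, hw⟩)
  have hlip : ∀ z ∈ Metric.closedBall (0 : ℂ) r, ∀ w ∈ Metric.closedBall (0 : ℂ) r,
      ‖f z - f w‖ ≤ Λ * ‖ψ z - ψ w‖ := fun z hz w hw =>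
    le_on_closure (fun x hx => (hball x hx).2) hf1.norm (hψ1.norm.const_mul Λ)
      (x := (z, w)) (by rw [hclosprod]; exact ⟨hz, hw⟩)
  -- the extension to the plane
  have hinjK : Set.InjOn ψ (Metric.closedBall 0 r) := hinj.mono hB1
  set κ := Function.invFunOn ψ (Metric.closedBall 0 r) with hκ
  have hleft : ∀ x ∈ Metric.closedBall (0 : ℂ) r, κ (ψ x) = x :=
    fun x hx => hinjK.leftInvOn_invFunOn hx
  obtain ⟨M, e, hM, he⟩ := exists_homeomorph_extend_normal (hne.image ψ) hKcl hKconv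
    (T := fun y => f (κ y)) hc0
    (by
      rintro _ ⟨x, hx, rfl⟩ _ ⟨y, hy, rfl⟩
      simp only [hleft x hx, hleft y hy]
      exact hmono x hx y hy)
    (by
      rintro _ ⟨x, hx, rfl⟩ _ ⟨y, hy, rfl⟩
      simp only [hleft x hx, hleft y hy]
      exact hlip x hx y hy)
  have he' : ∀ z ∈ Metric.closedBall (0 : ℂ) r, ∀ m, (∀ x ∈ K, inner ℝ m (x - ψ z) ≤ 0) →
      e (ψ z + m) = f z + M • m := fun z hz m hm => by
    have := he (ψ z) ⟨z, hz, rfl⟩ m hm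
    simp only [hleft z hz] at this
    exact this
  have hef : ∀ z ∈ Metric.closedBall (0 : ℂ) r, e (ψ z) = f z := fun z hz => by
    simpa using he' z hz 0 (by simp)
  have himg : f '' Metric.ball 0 r = e '' (ψ '' Metric.ball 0 r) := by
    rw [Set.image_image]
    exact Set.image_congr fun z hz => (hef z (hBB hz)).symm
  have hnormal : ∀ z ∈ Metric.sphere (0 : ℂ) r, ∀ t : ℝ, 0 ≤ t → ∀ x ∈ K,
      inner ℝ (t • (z * D z)) (x - ψ z) ≤ 0 := by
    rintro z hz t ht _ ⟨x, hx, rfl⟩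
    rw [mem_sphere_zero_iff_norm] at hz
    rw [mem_closedBall_zero_iff, ← hz] at hx
    rw [real_inner_smul_left]
    refine mul_nonpos_of_nonneg_of_nonpos ht ?_
    by_cases hxz : x = z
    · rw [hxz, sub_self, inner_zero_right]
    · exact (inner_lt_zero_of_norm_le hA hP hre hψ (by simpa [hz] using hr1)
        (norm_ne_zero_iff.1 (by linarith)) hx hxz).le
  refine ⟨fun z hz w hw hzw => ?_, ?_, ?_, ?_⟩
  · have : e (ψ z) = e (ψ w) := by rw [hef z (hBB hz), hef w (hBB hw)]; exact hzw
    exact hinjK (hBB hz) (hBB hw) (e.injective this)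
  · rw [himg]
    exact e.isOpenMap _ hO
  · rw [himg]
    exact (hOconv.isConnected ⟨ψ 0, 0, by simpa using hr0, rfl⟩).image _ e.continuous.continuousOn
  -- These are the images under `e` of the outward normal half-lines of `K`, with endpoints on the
  -- image of the circle.
  · refine ⟨{L | ∃ z ∈ Metric.sphere (0 : ℂ) r,
      L = {w : ℂ | ∃ t : ℝ, 0 ≤ t ∧ w = f z + (t : ℂ) * (z * D z)}}, ?_, ?_, ?_⟩
    · rintro L ⟨z, hz, rfl⟩
      refine ⟨f z, z * D z, mul_ne_zero ?_ (hDne z), rfl⟩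
      rw [mem_sphere_zero_iff_norm] at hz
      exact norm_ne_zero_iff.1 (by linarith)
    all_goals
      have hray : ∀ z ∈ Metric.sphere (0 : ℂ) r, ∀ t : ℝ, 0 ≤ t →
          f z + (t : ℂ) * (z * D z) = e (ψ z + (t / M) • (z * D z)) := fun z hz t ht => by
        rw [he' z (Metric.sphere_subset_closedBall hz) _ (hnormal z hz _ (by positivity)),
          smul_smul, mul_div_cancel₀ t hM.ne', Complex.real_smul]
    · rintro _ ⟨z, hz, rfl⟩ _ ⟨w, hw, rfl⟩ hzw
      rw [Set.disjoint_left]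
      rintro _ ⟨t, ht, rfl⟩ ⟨s, hs, h⟩
      rw [hray z hz t ht, hray w hw s hs] at h
      have h1 := eq_of_add_normal_eq (K := K) ⟨z, Metric.sphere_subset_closedBall hz, rfl⟩
        ⟨w, Metric.sphere_subset_closedBall hw, rfl⟩ (hnormal z hz _ (by positivity))
        (hnormal w hw _ (by positivity)) (e.injective h)
      have h2 := hinjK (Metric.sphere_subset_closedBall hz) (Metric.sphere_subset_closedBall hw) h1
      exact hzw (by rw [h2])
    · ext y
      constructor
      · rintro ⟨_, ⟨z, hz, rfl⟩, t, ht, rfl⟩ ⟨w, hw, hwy⟩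
        rw [hray z hz t ht] at hwy
        change f w = _ at hwy
        rw [← hef w (hBB hw), ← add_zero (ψ w)] at hwy
        have h1 := eq_of_add_normal_eq (K := K) ⟨w, hBB hw, rfl⟩
          ⟨z, Metric.sphere_subset_closedBall hz, rfl⟩ (by simp) (hnormal z hz _ (by positivity))
          (e.injective hwy)
        have h2 := hinjK (hBB hw) (Metric.sphere_subset_closedBall hz) h1
        rw [h2] at hw
        rw [mem_sphere_zero_iff_norm] at hz
        rw [mem_ball_zero_iff] at hw
        linarith
      · intro hy
        obtain ⟨q, rfl⟩ := e.surjective y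
        have hq : q ∉ ψ '' Metric.ball 0 r := fun h => hy (himg ▸ Set.mem_image_of_mem e h)
        obtain ⟨_, ⟨z, hz, rfl⟩, hn⟩ := exists_add_normal_eq (hne.image ψ) hKcl hKconv q
        -- The projection of `q` lies on the boundary: from an interior point a small move towards
        -- `q` would stay in `K`, against the normal inequality.
        have hzr : ‖z‖ = r := by
          rw [mem_closedBall_zero_iff] at hz
          refine hz.eq_or_lt.resolve_right fun hlt' => hq ?_
          have hzO : ψ z ∈ ψ '' Metric.ball 0 r := ⟨z, by simpa using hlt', rfl⟩
          have hcont : Filter.Tendsto (fun t : ℝ => ψ z + t • (q - ψ z))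
              (nhdsWithin 0 (Set.Ioi 0)) (nhds (ψ z)) := by
            have : Continuous fun t : ℝ => ψ z + t • (q - ψ z) := by fun_prop
            have h2 := this.tendsto 0
            simp only [zero_smul, add_zero] at h2
            exact h2.mono_left nhdsWithin_le_nhds
          obtain ⟨t, ht, ht0⟩ :=
            ((hcont.eventually (hO.mem_nhds hzO)).and self_mem_nhdsWithin).exists
          have h3 := hn _ (Set.image_mono hBB ht)
          rw [add_sub_cancel_left, inner_smul_right, real_inner_self_eq_norm_sq] at h3
          have h4 : ‖q - ψ z‖ ^ 2 ≤ 0 := nonpos_of_mul_nonpos_right h3 ht0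
          have h5 : q - ψ z = 0 := norm_eq_zero.1 (by nlinarith [norm_nonneg (q - ψ z)])
          rwa [sub_eq_zero.1 h5]
        have hz0 : z ≠ 0 := norm_ne_zero_iff.1 (by linarith)
        have hz1 := hB1 hz
        obtain ⟨t, ht, hm⟩ := exists_eq_smul_of_normal (hψ z hz1) (mul_ne_zero hz0 (hDne z))
          (inner_lt_zero_of_norm_le hA hP hre hψ hz1 hz0 (by simp) hz0.symm)
          (fun x hx => hn _ ⟨x, by rwa [hzr] at hx, rfl⟩)
        refine ⟨_, ⟨z, by simpa using hzr, rfl⟩, M * t, by positivity, ?_⟩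
        rw [hray z (by simpa using hzr) _ (by positivity), mul_div_cancel_left₀ t hM.ne', ← hm,
          add_sub_cancel]

/-! ### The auxiliary convex function and the radius -/

/-- A nonvanishing holomorphic function on the unit disk is, up to a constant factor, a power of an
exponential. -/
theorem exists_eq_exp_of_deriv_ne_zero {F : ℂ → ℂ} (hF : DifferentiableOn ℂ F (Metric.ball 0 1))
    (hne : ∀ z ∈ Metric.ball (0 : ℂ) 1, F z ≠ 0) {b : ℂ} (hb : b ≠ 0) :
    ∃ P : ℂ → ℂ, P 0 = 0 ∧
      (∀ z ∈ Metric.ball (0 : ℂ) 1, HasDerivAt P (deriv F z / F z / b) z) ∧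
      ∀ z ∈ Metric.ball (0 : ℂ) 1, F z = F 0 * Complex.exp (b * P z) := by
  have hd : DifferentiableOn ℂ (fun z => deriv F z / F z / b) (Metric.ball 0 1) :=
    ((hF.deriv Metric.isOpen_ball).div hF hne).div_const b
  obtain ⟨P, hP0, hP⟩ := hd.isExactOn_ball.with_val_at 0 0
  refine ⟨P, hP0, hP, fun z hz => ?_⟩
  have hconst : ∀ w ∈ Metric.ball (0 : ℂ) 1,
      HasDerivAt (fun w => F w * Complex.exp (-(b * P w))) 0 w := by
    intro w hw
    have h1 := (hF.differentiableAt (Metric.isOpen_ball.mem_nhds hw)).hasDerivAt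
    have h2 := h1.mul ((hP w hw).const_mul b).neg.cexp
    refine h2.congr_deriv ?_
    have := hne w hw
    field_simp
    ring
  have h0 : (0 : ℂ) ∈ Metric.ball (0 : ℂ) 1 := by simp
  have h3 := Metric.isOpen_ball.is_const_of_deriv_eq_zero (convex_ball (0 : ℂ) 1).isPreconnected
    (fun w hw => (hconst w hw).differentiableAt.differentiableWithinAt)
    (fun w hw => (hconst w hw).deriv) hz h0
  simp only [hP0, mul_zero, neg_zero, Complex.exp_zero, mul_one] at h3
  rw [← h3, mul_assoc, ← Complex.exp_add, neg_add_cancel, Complex.exp_zero, mul_one]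

/-- Jordan's inequality gives `cos x ≥ sin (a π / 2) ≥ a`; passing to `a / (a + N)` only loses, and
provides strictness. -/
theorem lt_cos_of_abs_le {x a N : ℝ} (ha0 : 0 < a) (ha1 : a < 1) (hN : 1 ≤ N)
    (hx : |x| ≤ (1 - a) * (Real.pi / 2)) : a / (a + N) < Real.cos x := by
  have hpi := Real.pi_pos
  have h1 : Real.cos ((1 - a) * (Real.pi / 2)) ≤ Real.cos x := by
    rw [← Real.cos_abs x]
    exact Real.cos_le_cos_of_nonneg_of_le_pi (abs_nonneg x) (by nlinarith) hx
  have h2 : Real.cos ((1 - a) * (Real.pi / 2)) = Real.sin (a * (Real.pi / 2)) := by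
    rw [← Real.cos_pi_div_two_sub]; ring_nf
  have h3 := Real.mul_le_sin (x := a * (Real.pi / 2)) (by positivity) (by nlinarith)
  have h4 : 2 / Real.pi * (a * (Real.pi / 2)) = a := by field_simp
  have h5 : a / (a + N) < a := by
    rw [div_lt_iff₀ (by positivity)]
    nlinarith
  linarith

theorem mainTheorem6 (n : ℕ) (hn : 2 ≤ n) (α : ℝ) (hα : -(1 / 2 : ℝ) < α) (hα0 : α < 0)
    (h g : ℂ → ℂ)
    (hh : DifferentiableOn ℂ h (Metric.ball 0 1))
    (hg : DifferentiableOn ℂ g (Metric.ball 0 1))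
    (hh_ne : ∀ z ∈ Metric.ball (0 : ℂ) 1, deriv h z ≠ 0)
    (hh_re : ∀ z ∈ Metric.ball (0 : ℂ) 1, α < (1 + z * deriv (deriv h) z / deriv h z).re)
    (hgh : ∀ z ∈ Metric.ball (0 : ℂ) 1, deriv g z = z ^ n * deriv h z) :
    IsCloseToConvexHarmonicOn (fun z => h z + (starRingEnd ℂ) (g z))
      (Metric.ball 0 (((1 + 2 * α) / (1 + 2 * (n : ℝ) + 2 * α)) ^ (1 / (n : ℝ)))) := by
  have hn0 : n ≠ 0 := by omega
  have hn2 : (2 : ℝ) ≤ n := by exact_mod_cast hn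
  set ρ : ℝ := (1 + 2 * α) / (1 + 2 * (n : ℝ) + 2 * α) with hρ
  set r : ℝ := ρ ^ (1 / (n : ℝ)) with hr
  have hρ0 : 0 < ρ := div_pos (by linarith) (by linarith)
  have hρ1 : ρ < 1 := by rw [hρ, div_lt_one (by linarith)]; linarith
  have hr0 : 0 < r := Real.rpow_pos_of_pos hρ0 _
  have hr1 : r < 1 := Real.rpow_lt_one hρ0.le hρ1 (by positivity)
  have hrn : r ^ n = ρ := by
    rw [hr, one_div]
    exact Real.rpow_inv_natCast_pow hρ0.le hn0
  have hb0 : (0 : ℝ) < 1 - α := by linarith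
  -- The exponent `1 - α` rescales `Re (z h''/h') > -(1 - α)` to `Re (z P') > -1`, the convexity
  -- condition for `ψ`.
  obtain ⟨P, hP0, hP, hhP⟩ := exists_eq_exp_of_deriv_ne_zero (hh.deriv Metric.isOpen_ball) hh_ne
    (b := ((1 - α : ℝ) : ℂ)) (by exact_mod_cast hb0.ne')
  have hre : ∀ z ∈ Metric.ball (0 : ℂ) 1,
      0 < (1 + z * (deriv (deriv h) z / deriv h z / ((1 - α : ℝ) : ℂ))).re := by
    intro z hz
    have h1 := hh_re z hz
    rw [mul_div_assoc, Complex.add_re, Complex.one_re] at h1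
    rw [← mul_div_assoc, Complex.add_re, Complex.one_re, Complex.div_ofReal_re]
    have h2 : -1 < (z * (deriv (deriv h) z / deriv h z)).re / (1 - α) := by
      rw [lt_div_iff₀ hb0]
      linarith
    linarith
  have hA : deriv h 0 ≠ 0 := hh_ne 0 (by simp)
  obtain ⟨ψ, hψ⟩ := DifferentiableOn.isExactOn_ball
    (f := fun z => deriv h 0 * Complex.exp (P z)) (c := 0) (r := 1)
    fun z hz => ((hP z hz).differentiableAt.cexp.const_mul _).differentiableWithinAt
  have hquot : ∀ z ∈ Metric.ball (0 : ℂ) 1,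
      deriv h z / (deriv h 0 * Complex.exp (P z)) = Complex.exp ((-α : ℝ) * P z) := by
    intro z hz
    rw [hhP z hz, mul_div_mul_left _ _ hA, ← Complex.exp_sub]
    congr 1
    push_cast
    ring
  have hlt : ∀ z ∈ Metric.closedBall (0 : ℂ) r,
      ‖deriv g z / (deriv h 0 * Complex.exp (P z))‖ <
        (deriv h z / (deriv h 0 * Complex.exp (P z))).re := by
    intro z hz
    have hz1 := Metric.closedBall_subset_ball hr1 hz
    rw [hgh z hz1, mul_div_assoc, hquot z hz1, norm_mul, norm_pow, Complex.norm_exp,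
      Complex.exp_re, mul_comm]
    refine mul_lt_mul_of_pos_left ?_ (Real.exp_pos _)
    rw [mem_closedBall_zero_iff] at hz
    have h1 : ‖z‖ ^ n ≤ ρ := hrn ▸ pow_le_pow_left₀ (norm_nonneg z) hz n
    refine h1.trans_lt ?_
    have h2 := abs_im_le_pi hP hre hP0 hz1
    -- With `a = 1 + 2 α`, the bound `(1 - a) π / 2` is `-α π`, and `N = 2 n` makes `a / (a + N)`
    -- equal to `ρ`.
    have h3 := lt_cos_of_abs_le (x := ((-α : ℝ) * P z).im) (a := 1 + 2 * α) (N := 2 * n)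
      (by linarith) (by linarith) (by linarith) (by
        rw [Complex.im_ofReal_mul, abs_mul, abs_of_pos (by linarith : 0 < -α)]
        have := mul_le_mul_of_nonneg_left h2 (by linarith : 0 ≤ -α)
        linarith)
    rw [hρ, show 1 + 2 * (n : ℝ) + 2 * α = 1 + 2 * α + 2 * n by ring]
    exact h3
  refine ⟨fun z hz => ?_, isCloseToConvexDomain_image_ball hA hP hre hψ hh hg hr0 hr1 hlt⟩
  have hz1 : Metric.ball (0 : ℂ) 1 ∈ nhds z :=
    Metric.isOpen_ball.mem_nhds (Metric.ball_subset_ball hr1.le hz)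
  exact (hh.analyticAt hz1).harmonicAt.add (hg.analyticAt hz1).harmonicAt_conj
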